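/- **Setting.** Let $i,j$ be two rectangular objects to be placed in a region of size $r_x\times r_y$. Object $k\in\{i,j\}$ has dimensions $d_{ks}\ge 0$ and clearances $\sigma^-_{ks},\sigma^+_{ks}\ge 0$ in direction $s\in\{x,y\}$. Put $LB_{ks}=\tfrac12 d_{ks}+\sigma^-_{ks}$ and $UB_{ks}=r_s-\tfrac12 d_{ks}-\sigma^+_{ks}$, let $\mathscr F_{ij}=\{(i,j,x),(j,i,x),(i,j,y),(j,i,y)\}$, and for $(k,l,s)\in\mathscr F_{ij}$ let $PM_{kls}\ge \tfrac12 d_{ks}+\tfrac12 d_{ls}+\max\{\sigma^+_{ks},\sigma^-_{ls}\}$ be real numbers (the precedence margins). The Simple Binary Multilinear formulation (SB-M) for this pair is the following mixed-binary linear program, with continuous variables $c_{ix},c_{iy},c_{jx},c_{jy},\Delta_{ij}\in\mathbb R$ and binary variables $\delta_{ij},\delta_{ji}\in\{0,1\}$: for all $(k,l,s)\in\mathscr F_{ij}$, $$c_{ls}\ge LB_{ks}+PM_{kls}-(LB_{ks}+PM_{kls}-LB_{ls})\,\beta_{kls},$$ $$c_{ks}\le UB_{ls}-PM_{kls}-(UB_{ls}-PM_{kls}-UB_{ks})\,\beta_{kls},$$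 $$c_{ls}-c_{ks}\ge PM_{kls}+(LB_{ls}-PM_{kls}-UB_{ks})\,\beta_{kls},$$ together with $$\delta_{ij}+\delta_{ji}-\Delta_{ij}\le 1,\qquad \Delta_{ij}\le\delta_{ij},\qquad \Delta_{ij}\le\delta_{ji},\qquad \Delta_{ij}\ge 0 .$$ Here $\beta_{kls}$ is the linearized comparison of $(\delta_{ij},\delta_{ji})$ with the Gray code $a=(a_1,a_2)$ of $(k,l,s)$, the codes being $(i,j,x)\mapsto(0,0)$, $(i,j,y)\mapsto(1,0)$, $(j,i,x)\mapsto(1,1)$, $(j,i,y)\mapsto(0,1)$: $$\beta_{kls}=\delta_{ij}+\delta_{ji}-\Delta_{ij}+a_1(1-a_2)(1-2\delta_{ij}-\delta_{ji}+2\Delta_{ij})+(1-a_1)a_2(1-\delta_{ij}-2\delta_{ji}+2\Delta_{ij})+a_1a_2(1-\delta_{ij}-\delta_{ji}),$$ that is, $\beta_{ijx}=\delta_{ij}+\delta_{ji}-\Delta_{ij}$, $\beta_{ijy}=1-\delta_{ij}+\Delta_{ij}$, $\beta_{jix}=1-\Delta_{ij}$, $\beta_{jiy}=1-\delta_{ji}+\Delta_{ij}$.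 A mixed-binary linear program with $m$ continuous and $n$ binary variables is *ideal* if every extreme point of its continuous relaxation (in which each binary variable is only required to lie in $[0,1]$) has all binary variables in $\{0,1\}$; an extreme point is a feasible point of the relaxation at which some $m+n$ of the relaxation's constraints, with linearly independent coefficient vectors, hold with equality. A formulation is *pairwise-ideal* if its restriction to two objects is ideal. **Theorem.** If $PM_{kls}<UB_{ls}-LB_{ks}$ for every $(k,l,s)\in\mathscr F_{ij}$, then SB-M is pairwise-ideal, i.e. the program above is ideal. The same conclusion holds for arbitrary real parameters $LB_{ks},UB_{ks},PM_{kls}$, not necessarily arising from rectangles as above, such that $LB_{ks}\le UB_{ks}$ for all $k\in\{i,j\}$, $s\in\{x,y\}$ and $PM_{kls}<UB_{ls}-LB_{ks}$ for all $(k,l,s)\in\mathscr F_{ij}$. -/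

import Mathlib

namespace RectPack

noncomputable section

/-! ### Mixed-binary linear programs and idealness -/

/-- The feasible region of a mixed-binary linear program with continuous variables indexed by `C`,
binary variables indexed by `B` and linear constraints indexed by `K`. A point is a vector
`z : C ⊕ B → ℝ`, and the constraint `k` is the affine inequality `0 ≤ con k z`
(the inequality `(A z)ₖ ≥ bₖ` is encoded by the affine function `z ↦ (A z)ₖ - bₖ`). -/
structure MBLP (C B K : Type) where
  con : K → ((C ⊕ B → ℝ) →ᵃ[ℝ] ℝ)

variable {C B K : Type}

/-- The coordinate `v`, as an affine function. -/
def coord (v : C ⊕ B) : (C ⊕ B → ℝ) →ᵃ[ℝ] ℝ :=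
  (LinearMap.proj v : (C ⊕ B → ℝ) →ₗ[ℝ] ℝ).toAffineMap

/-- A constant, as an affine function. -/
def cst (a : ℝ) : (C ⊕ B → ℝ) →ᵃ[ℝ] ℝ :=
  AffineMap.const ℝ (C ⊕ B → ℝ) a

/-- The constraints of the continuous relaxation: the linear constraints of the program, together
with `0 ≤ y` and `y ≤ 1` for each binary variable `y`. -/
def MBLP.relaxedCon (P : MBLP C B K) : K ⊕ (B ⊕ B) → ((C ⊕ B → ℝ) →ᵃ[ℝ] ℝ)
  | .inl k => P.con k
  | .inr (.inl y) => coord (.inr y)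
  | .inr (.inr y) => cst 1 - coord (.inr y)

/-- Feasibility for the continuous relaxation. -/
def MBLP.IsRelaxedFeasible (P : MBLP C B K) (z : C ⊕ B → ℝ) : Prop :=
  ∀ q, 0 ≤ P.relaxedCon q z

/-- Extreme points of the continuous relaxation: its feasible points at which `m + n` of its
constraints with linearly independent coefficient rows are tight, where `m` is the number of
continuous variables and `n` the number of binary variables. -/
def MBLP.IsExtremePoint [Fintype C] [Fintype B] (P : MBLP C B K) (z : C ⊕ B → ℝ) : Prop :=
  P.IsRelaxedFeasible z ∧
    ∃ T : Finset (K ⊕ (B ⊕ B)),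
      T.card = Fintype.card C + Fintype.card B ∧
      LinearIndependent ℝ (fun q : T => (P.relaxedCon q.1).linear) ∧
      ∀ q ∈ T, P.relaxedCon q z = 0

/-- A program is ideal if its continuous relaxation has no fractional extreme point. -/
def MBLP.IsIdeal [Fintype C] [Fintype B] (P : MBLP C B K) : Prop :=
  ∀ z, P.IsExtremePoint z → ∀ y : B, z (.inr y) = 0 ∨ z (.inr y) = 1

/-! ### The Simple Binary Multilinear formulation for two objects -/

/-- The two objects. -/
inductive Obj
  | i
  | j
  deriving DecidableEq

instance : Fintype Obj :=
  ⟨{.i, .j}, by intro a; cases a <;> simp⟩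

/-- The two directions. -/
inductive Dir
  | x
  | y
  deriving DecidableEq

instance : Fintype Dir :=
  ⟨{.x, .y}, by intro a; cases a <;> simp⟩

/-- The index set `{(i,j,x), (j,i,x), (i,j,y), (j,i,y)}`: triples `(k,l,s)` of two distinct
objects and a direction. -/
abbrev Triple : Type := {p : Obj × Obj × Dir // p.1 ≠ p.2.1}

/-- Continuous variables: the coordinates `c_{ks}` of the centres, indexed by the pairs `(k, s)`,
and one further variable `Δ_{ij}`. -/
abbrev ContVar : Type := (Obj × Dir) ⊕ Unit

/-- Binary variables: `δ_{ij}` and `δ_{ji}`. -/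
inductive BinVar
  | ij
  | ji
  deriving DecidableEq

instance : Fintype BinVar :=
  ⟨{.ij, .ji}, by intro a; cases a <;> simp⟩

/-- The Gray code assigned to the disjunctive term "`k` precedes `l` in direction `s`", where `k`
is the first argument (and `l` is the other object): `(i,j,x) ↦ (0,0)`, `(i,j,y) ↦ (1,0)`,
`(j,i,x) ↦ (1,1)`, `(j,i,y) ↦ (0,1)`. -/
def code : Obj → Dir → ℝ × ℝ
  | .i, .x => (0, 0)
  | .i, .y => (1, 0)
  | .j, .x => (1, 1)
  | .j, .y => (0, 1)

/-- Affine functions of the variables of the formulation. -/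
abbrev Aff : Type := (ContVar ⊕ BinVar → ℝ) →ᵃ[ℝ] ℝ

/-- The variable `c_{ks}`. -/
def c (k : Obj) (s : Dir) : Aff := coord (.inl (.inl (k, s)))

/-- The variable `Δ_{ij}`. -/
def Δij : Aff := coord (.inl (.inr ()))

/-- The variable `δ_{ij}`. -/
def δij : Aff := coord (.inr BinVar.ij)

/-- The variable `δ_{ji}`. -/
def δji : Aff := coord (.inr BinVar.ji)

/-- The linearized multilinear comparison function of the code `a` and `(δ_{ij}, δ_{ji})`, in
which `Δ_{ij}` replaces the product `δ_{ij} δ_{ji}`. -/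
def comparison (a : ℝ × ℝ) : Aff :=
  δij + δji - Δij
    + (a.1 * (1 - a.2)) • (cst 1 - (2 : ℝ) • δij - δji + (2 : ℝ) • Δij)
    + ((1 - a.1) * a.2) • (cst 1 - δij - (2 : ℝ) • δji + (2 : ℝ) • Δij)
    + (a.1 * a.2) • (cst 1 - δij - δji)

/-- Names of the constraints. -/
inductive SBMCon
  | lb (p : Triple)
  | ub (p : Triple)
  | prec (p : Triple)
  | mcSum
  | mcIJ
  | mcJI
  | mcNonneg

/-- The Simple Binary Multilinear formulation for two objects, with lower bounds `LB k s` and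
upper bounds `UB k s` on `c_{ks}` and precedence margins `PM k l s`. -/
def SBM (LB UB : Obj → Dir → ℝ) (PM : Obj → Obj → Dir → ℝ) : MBLP ContVar BinVar SBMCon where
  con
    -- c_ls ≥ LB_ks + PM_kls - (LB_ks + PM_kls - LB_ls) * comparison
    | .lb ⟨(k, l, s), _⟩ =>
        c l s - (cst (LB k s + PM k l s)
          - (LB k s + PM k l s - LB l s) • comparison (code k s))
    -- c_ks ≤ UB_ls - PM_kls - (UB_ls - PM_kls - UB_ks) * comparison
    | .ub ⟨(k, l, s), _⟩ =>
        (cst (UB l s - PM k l s)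
          - (UB l s - PM k l s - UB k s) • comparison (code k s)) - c k s
    -- c_ls - c_ks ≥ PM_kls + (LB_ls - PM_kls - UB_ks) * comparison
    | .prec ⟨(k, l, s), _⟩ =>
        (c l s - c k s) - (cst (PM k l s)
          + (LB l s - PM k l s - UB k s) • comparison (code k s))
    -- the McCormick envelope of Δ_ij = δ_ij * δ_ji
    | .mcSum => cst 1 - (δij + δji - Δij)
    | .mcIJ => δij - Δij
    | .mcJI => δji - Δij
    | .mcNonneg => Δij

/-! ### The parameters coming from rectangles with clearances -/

/-- The lower bound on `c_{ks}` for dimensions `d` and clearances `σm` on the lower faces. -/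
def lowerBound (d σm : Obj → Dir → ℝ) (k : Obj) (s : Dir) : ℝ :=
  d k s / 2 + σm k s

/-- The upper bound on `c_{ks}` for a region with dimensions `r`, object dimensions `d` and
clearances `σp` on the upper faces. -/
def upperBound (r : Dir → ℝ) (d σp : Obj → Dir → ℝ) (k : Obj) (s : Dir) : ℝ :=
  r s - d k s / 2 - σp k s

/-- The precedence margin determined by the dimensions and the clearances. -/
def precedenceMargin (d σm σp : Obj → Dir → ℝ) (k l : Obj) (s : Dir) : ℝ :=
  d k s / 2 + d l s / 2 + max (σp k s) (σm l s)

end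

end RectPack

/-! The numbers `1 - comparison (code k s)`, one for each triple `(k, l, s)`, are barycentric
coordinates on the McCormick tetrahedron: they are its four facet functionals and add up to `1`.
An extreme point cannot be moved within all of its tight constraints
(`MBLP.IsExtremePoint.eq_zero_of_tight`), so it is enough to move every fractional point.

If `δ` is the fractional binary variable at the point, multiply the weight of each triple by the
difference between the value (`0` or `1`) of that variable in the code of the triple and `δ`. The
resulting direction has total weight `0`, fixes every vanishing weight, and changes `δ` by
`δ * (1 - δ) ≠ 0`.

It remains to let the centres follow. The constraints on the centres split into the two directions
of space, and in one direction there are six of them: two bounds on each of `c_i`, `c_j` and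
`c_j - c_i`, with right-hand sides affine in the two weights belonging to that direction. By the
strict inequality on the precedence margins, the two bounds on one quantity cannot both be tight
unless both weights vanish (`weights_eq_zero_of_eq`). So at most three constraints are tight, one
on each of the three quantities, and three tight constraints force one of the weights to vanish in
such a way that the three prescribed velocities are compatible
(`exists_velocity_of_weights`). -/

namespace RectPack

/-! ### Extreme points and tight directions -/

theorem MBLP.IsExtremePoint.eq_zero_of_tight {C B K : Type} [Fintype C] [Fintype B]
    {P : MBLP C B K} {z v : C ⊕ B → ℝ} (hz : P.IsExtremePoint z)
    (hv : ∀ q, P.relaxedCon q z = 0 → (P.relaxedCon q).linear v = 0) : v = 0 := by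
  obtain ⟨-, T, hcard, hli, hT⟩ := hz
  have hspan := hli.span_eq_top_of_card_eq_finrank' (by
    rw [Fintype.card_coe, hcard, ← Fintype.card_sum]
    exact ((Subspace.dual_finrank_eq (K := ℝ) (V := C ⊕ B → ℝ)).trans
      (Module.finrank_fintype_fun_eq_card ℝ)).symm)
  have key : ∀ f : (C ⊕ B → ℝ) →ₗ[ℝ] ℝ, f v = 0 := by
    intro f
    have hf : f ∈ Submodule.span ℝ (Set.range fun q : T => (P.relaxedCon q.1).linear) := by
      rw [hspan]; trivial
    induction hf using Submodule.span_induction with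
    | mem g hg => obtain ⟨q, rfl⟩ := hg; exact hv q.1 (hT q.1 q.2)
    | zero => rfl
    | add g h _ _ hg hh => simp [hg, hh]
    | smul a g _ hg => simp [hg]
  funext w
  exact key (LinearMap.proj w)

/-! ### Velocities of the centres in one direction -/

theorem exists_eq_of_not_and {P Q : Prop} (h : ¬(P ∧ Q)) (a b : ℝ) :
    ∃ x, (P → x = a) ∧ (Q → x = b) := by
  by_cases hP : P
  · exact ⟨a, fun _ => rfl, fun hQ => (h ⟨hP, hQ⟩).elim⟩
  · exact ⟨b, fun h => (hP h).elim, fun _ => rfl⟩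

/-- Prescribed values for `x`, `y` and `y - x` can be met as soon as they are compatible where all
three are required. -/
theorem exists_eq_eq_sub_eq {P Q R : Prop} {a b e : ℝ} (h : P → Q → R → b - a = e) :
    ∃ x y, (P → x = a) ∧ (Q → y = b) ∧ (R → y - x = e) := by
  by_cases hP : P
  · by_cases hQ : Q
    · exact ⟨a, b, fun _ => rfl, fun _ => rfl, h hP hQ⟩
    · exact ⟨a, a + e, fun _ => rfl, fun h => (hQ h).elim, fun _ => by ring⟩
  · exact ⟨b - e, b, fun h => (hP h).elim, fun _ => rfl, fun _ => by ring⟩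

/-- Applied to a quantity confined to an interval of length `W` that shrinks by `p * a + q * b`:
the interval degenerates to a point only if both weights vanish. -/
theorem weights_eq_zero_of_eq {W a b p q : ℝ} (hW : 0 ≤ W) (ha : a < W) (hb : b < W)
    (hp : 0 ≤ p) (hq : 0 ≤ q) (hpq : p + q ≤ 1) (h : W = p * a + q * b) : p = 0 ∧ q = 0 := by
  have h0 : 0 ≤ (1 - p - q) * W := mul_nonneg (by linarith) hW
  have h1 : 0 ≤ p * (W - a) := mul_nonneg hp (by linarith)
  have h2 : 0 ≤ q * (W - b) := mul_nonneg hq (by linarith)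
  have h1' : p * (W - a) = 0 := by nlinarith
  have h2' : q * (W - b) = 0 := by nlinarith
  exact ⟨(mul_eq_zero.1 h1').resolve_right (by linarith),
    (mul_eq_zero.1 h2').resolve_right (by linarith)⟩

theorem weight_eq_zero_and_width_eq_zero {W a p q : ℝ} (hW : 0 ≤ W) (ha : a < W)
    (hq : 0 ≤ q) (hp : p < 1) (hpq : p + q ≤ 1) (h : (1 - p) * W = q * a) : q = 0 ∧ W = 0 := by
  have h0 : 0 ≤ (1 - p - q) * W := mul_nonneg (by linarith) hW
  have h1 : 0 ≤ q * (W - a) := mul_nonneg hq (by linarith)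
  have h1' : q * (W - a) = 0 := by nlinarith
  have hq0 : q = 0 := (mul_eq_zero.1 h1').resolve_right (by linarith)
  refine ⟨hq0, ?_⟩
  rw [hq0, zero_mul] at h
  exact (mul_eq_zero.1 h).resolve_left (by linarith)

/-- In one direction of space, let `x ∈ [Lx, Ux]` and `y ∈ [Ly, Uy]` be the centres of two objects
and `M`, `N` the margins for "`x` before `y`" and "`y` before `x`", with weights `p` and `q`. If
the weights change at rates `dp`, `dq` that vanish with the weights, then the centres can change
at rates `dx`, `dy` that keep every tight constraint tight. -/
theorem exists_velocity_of_weights {Lx Ly Ux Uy M N x y p q dp dq : ℝ}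
    (hx : Lx ≤ Ux) (hy : Ly ≤ Uy) (hM : M < Uy - Lx) (hN : N < Ux - Ly)
    (hp : 0 ≤ p) (hq : 0 ≤ q) (hp1 : p < 1) (hq1 : q < 1) (hpq : p + q ≤ 1)
    (hdp : p = 0 → dp = 0) (hdq : q = 0 → dq = 0)
    (hxy : Ly - Ux + p * (M - Ly + Ux) ≤ y - x)
    (hyx : Lx - Uy + q * (N - Lx + Uy) ≤ x - y) :
    ∃ dx dy,
      (x = Lx + q * (Ly + N - Lx) → dx = dq * (Ly + N - Lx)) ∧
      (x = Ux - p * (M + Ux - Uy) → dx = -(dp * (M + Ux - Uy))) ∧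
      (y = Ly + p * (Lx + M - Ly) → dy = dp * (Lx + M - Ly)) ∧
      (y = Uy - q * (N + Uy - Ux) → dy = -(dq * (N + Uy - Ux))) ∧
      (y - x = Ly - Ux + p * (M - Ly + Ux) → dy - dx = dp * (M - Ly + Ux)) ∧
      (x - y = Lx - Uy + q * (N - Lx + Uy) → dx - dy = dq * (N - Lx + Uy)) := by
  by_cases h0 : p = 0 ∧ q = 0
  · obtain ⟨h1, h2⟩ := h0
    refine ⟨0, 0, ?_⟩
    simp [hdp h1, hdq h2]
  -- Away from zero weights, each of `x`, `y`, `y - x` ranges over a nondegenerate interval.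
  obtain ⟨a, ha1, ha2⟩ := exists_eq_of_not_and (P := x = Lx + q * (Ly + N - Lx))
    (Q := x = Ux - p * (M + Ux - Uy))
    (fun h => h0 (weights_eq_zero_of_eq (W := Ux - Lx) (a := M + Ux - Uy) (b := Ly + N - Lx)
      (by linarith) (by linarith) (by linarith) hp hq hpq (by linarith [h.1, h.2])))
    (dq * (Ly + N - Lx)) (-(dp * (M + Ux - Uy)))
  obtain ⟨b, hb1, hb2⟩ := exists_eq_of_not_and (P := y = Ly + p * (Lx + M - Ly))
    (Q := y = Uy - q * (N + Uy - Ux))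
    (fun h => h0 (weights_eq_zero_of_eq (W := Uy - Ly) (a := Lx + M - Ly) (b := N + Uy - Ux)
      (by linarith) (by linarith) (by linarith) hp hq hpq (by linarith [h.1, h.2])))
    (dp * (Lx + M - Ly)) (-(dq * (N + Uy - Ux)))
  obtain ⟨e, he1, he2⟩ := exists_eq_of_not_and
    (P := y - x = Ly - Ux + p * (M - Ly + Ux)) (Q := x - y = Lx - Uy + q * (N - Lx + Uy))
    (fun h => h0 (weights_eq_zero_of_eq (W := Ux - Lx + (Uy - Ly)) (a := M - Ly + Ux)
      (b := N - Lx + Uy)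
      (by linarith) (by linarith) (by linarith) hp hq hpq (by linarith [h.1, h.2])))
    (dp * (M - Ly + Ux)) (-(dq * (N - Lx + Uy)))
  obtain ⟨dx, dy, h1, h2, h3⟩ := exists_eq_eq_sub_eq
    (P := x = Lx + q * (Ly + N - Lx) ∨ x = Ux - p * (M + Ux - Uy))
    (Q := y = Ly + p * (Lx + M - Ly) ∨ y = Uy - q * (N + Uy - Ux))
    (R := y - x = Ly - Ux + p * (M - Ly + Ux) ∨ x - y = Lx - Uy + q * (N - Lx + Uy))
    (a := a) (b := b) (e := e) (by
      rintro (hX | hX) (hY | hY) (hD | hD)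
      · obtain ⟨h, hW⟩ := weight_eq_zero_and_width_eq_zero (W := Ux - Lx) (a := Ly + N - Lx)
          (p := p) (q := q) (by linarith) (by linarith) hq hp1 hpq (by linarith)
        rw [ha1 hX, hb1 hY, he1 hD, hdq h]
        linear_combination (-dp) * hW
      · obtain ⟨h, hW⟩ := weight_eq_zero_and_width_eq_zero (W := Uy - Ly) (a := Lx + M - Ly)
          (p := q) (q := p) (by linarith) (by linarith) hp hq1 (by linarith) (by linarith)
        rw [ha1 hX, hb1 hY, he2 hD, hdp h]
        linear_combination dq * hW
      -- The corner (lower `x`, upper `y`) violates the bound on `x - y` by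
      -- `q * (Ux - Ly - N)`, so it is feasible only for `q = 0`.
      · have h : q = 0 := by
          have : q * (Ux - Ly - N) ≤ 0 := by linarith
          nlinarith
        exfalso
        have hp0 := (weights_eq_zero_of_eq (W := Ux - Lx + (Uy - Ly)) (a := M - Ly + Ux)
          (b := N - Lx + Uy) (by linarith) (by linarith) (by linarith) hp hq hpq
          (by rw [h] at hX hY ⊢; linarith)).1
        exact h0 ⟨hp0, h⟩
      · have h : q = 0 := by
          have : q * (Ux - Ly - N) ≤ 0 := by linarith
          nlinarith
        rw [ha1 hX, hb2 hY, he2 hD, hdq h]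
        ring
      -- Symmetrically, the corner (upper `x`, lower `y`) is feasible only for `p = 0`.
      · have h : p = 0 := by
          have : p * (Uy - Lx - M) ≤ 0 := by linarith
          nlinarith
        rw [ha2 hX, hb1 hY, he1 hD, hdp h]
        ring
      · have h : p = 0 := by
          have : p * (Uy - Lx - M) ≤ 0 := by linarith
          nlinarith
        exfalso
        have hq0 := (weights_eq_zero_of_eq (W := Ux - Lx + (Uy - Ly)) (a := M - Ly + Ux)
          (b := N - Lx + Uy) (by linarith) (by linarith) (by linarith) hp hq hpq
          (by rw [h] at hX hY ⊢; linarith)).2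
        exact h0 ⟨h, hq0⟩
      · obtain ⟨h, hW⟩ := weight_eq_zero_and_width_eq_zero (W := Uy - Ly) (a := N + Uy - Ux)
          (p := p) (q := q) (by linarith) (by linarith) hq hp1 hpq (by linarith)
        rw [ha2 hX, hb2 hY, he1 hD, hdq h]
        linear_combination (-dp) * hW
      · obtain ⟨h, hW⟩ := weight_eq_zero_and_width_eq_zero (W := Ux - Lx) (a := M + Ux - Uy)
          (p := q) (q := p) (by linarith) (by linarith) hp hq1 (by linarith) (by linarith)
        rw [ha2 hX, hb2 hY, he2 hD, hdp h]
        linear_combination dq * hW)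
  refine ⟨dx, dy, fun h => ?_, fun h => ?_, fun h => ?_, fun h => ?_, fun h => ?_, fun h => ?_⟩
  · rw [h1 (.inl h), ha1 h]
  · rw [h1 (.inr h), ha2 h]
  · rw [h2 (.inl h), hb1 h]
  · rw [h2 (.inr h), hb2 h]
  · rw [h3 (.inl h), he1 h]
  · linarith [h3 (.inr h), he2 h]

/-! ### Weights of the triples -/

/-- The weight of the triple with first object `k` and direction `s` at a point: `1` minus the
linearized comparison with its code. -/
def weight (k : Obj) (s : Dir) (z : ContVar ⊕ BinVar → ℝ) : ℝ :=
  1 - comparison (code k s) z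

/-- The rate of change of `weight k s` along a direction. -/
def weightRate (k : Obj) (s : Dir) (v : ContVar ⊕ BinVar → ℝ) : ℝ :=
  -(comparison (code k s)).linear v

theorem comparison_apply (k : Obj) (s : Dir) (z : ContVar ⊕ BinVar → ℝ) :
    comparison (code k s) z = 1 - weight k s z := by
  rw [weight]; ring

theorem comparison_linear (k : Obj) (s : Dir) (v : ContVar ⊕ BinVar → ℝ) :
    (comparison (code k s)).linear v = -weightRate k s v := by
  rw [weightRate]; ring

theorem coord_apply {C B : Type} (w : C ⊕ B) (z : C ⊕ B → ℝ) : coord w z = z w := rfl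

theorem coord_linear {C B : Type} (w : C ⊕ B) (z : C ⊕ B → ℝ) : (coord w).linear z = z w := rfl

theorem cst_apply {C B : Type} (a : ℝ) (z : C ⊕ B → ℝ) : cst a z = a := rfl

theorem cst_linear {C B : Type} (a : ℝ) : (cst (C := C) (B := B) a).linear = 0 := rfl

section

variable (z v : ContVar ⊕ BinVar → ℝ)

theorem weight_i_x : weight .i .x z
    = 1 - z (.inr .ij) - z (.inr .ji) + z (.inl (.inr ())) := by
  simp [weight, comparison, code, δij, δji, Δij, coord_apply]; ring

theorem weight_i_y : weight .i .y z = z (.inr .ij) - z (.inl (.inr ())) := by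
  simp [weight, comparison, code, δij, δji, Δij, coord_apply, cst_apply]; ring

theorem weight_j_x : weight .j .x z = z (.inl (.inr ())) := by
  simp [weight, comparison, code, δij, δji, Δij, coord_apply, cst_apply]; ring

theorem weight_j_y : weight .j .y z = z (.inr .ji) - z (.inl (.inr ())) := by
  simp [weight, comparison, code, δij, δji, Δij, coord_apply, cst_apply]; ring

theorem weightRate_i_x : weightRate .i .x v
    = -v (.inr .ij) - v (.inr .ji) + v (.inl (.inr ())) := by
  simp [weightRate, comparison, code, δij, δji, Δij, coord_linear]; ring

theorem weightRate_i_y : weightRate .i .y v = v (.inr .ij) - v (.inl (.inr ())) := by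
  simp [weightRate, comparison, code, δij, δji, Δij, coord_linear, cst_linear]; ring

theorem weightRate_j_x : weightRate .j .x v = v (.inl (.inr ())) := by
  simp [weightRate, comparison, code, δij, δji, Δij, coord_linear, cst_linear]; ring

theorem weightRate_j_y : weightRate .j .y v = v (.inr .ji) - v (.inl (.inr ())) := by
  simp [weightRate, comparison, code, δij, δji, Δij, coord_linear, cst_linear]; ring

end

/-! ### Constraints in terms of the weights -/

section

variable {LB UB : Obj → Dir → ℝ} {PM : Obj → Obj → Dir → ℝ} {z v : ContVar ⊕ BinVar → ℝ}

theorem lb_apply {k l : Obj} {s : Dir} (h : k ≠ l) :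
    (SBM LB UB PM).con (.lb ⟨(k, l, s), h⟩) z = z (.inl (.inl (l, s)))
      - (LB l s + weight k s z * (LB k s + PM k l s - LB l s)) := by
  simp [SBM, c, comparison_apply, coord_apply, cst_apply]; ring

theorem lb_linear {k l : Obj} {s : Dir} (h : k ≠ l) :
    ((SBM LB UB PM).con (.lb ⟨(k, l, s), h⟩)).linear v = v (.inl (.inl (l, s)))
      - weightRate k s v * (LB k s + PM k l s - LB l s) := by
  simp [SBM, c, comparison_linear, coord_linear, cst_linear]; ring

theorem ub_apply {k l : Obj} {s : Dir} (h : k ≠ l) :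
    (SBM LB UB PM).con (.ub ⟨(k, l, s), h⟩) z
      = UB k s - weight k s z * (PM k l s + UB k s - UB l s) - z (.inl (.inl (k, s))) := by
  simp [SBM, c, comparison_apply, coord_apply, cst_apply]; ring

theorem ub_linear {k l : Obj} {s : Dir} (h : k ≠ l) :
    ((SBM LB UB PM).con (.ub ⟨(k, l, s), h⟩)).linear v
      = -(weightRate k s v * (PM k l s + UB k s - UB l s)) - v (.inl (.inl (k, s))) := by
  simp [SBM, c, comparison_linear, coord_linear, cst_linear]; ring

theorem prec_apply {k l : Obj} {s : Dir} (h : k ≠ l) :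
    (SBM LB UB PM).con (.prec ⟨(k, l, s), h⟩) z
      = z (.inl (.inl (l, s))) - z (.inl (.inl (k, s)))
        - (LB l s - UB k s + weight k s z * (PM k l s - LB l s + UB k s)) := by
  simp [SBM, c, comparison_apply, coord_apply, cst_apply]; ring

theorem prec_linear {k l : Obj} {s : Dir} (h : k ≠ l) :
    ((SBM LB UB PM).con (.prec ⟨(k, l, s), h⟩)).linear v
      = v (.inl (.inl (l, s))) - v (.inl (.inl (k, s)))
        - weightRate k s v * (PM k l s - LB l s + UB k s) := by
  simp [SBM, c, comparison_linear, coord_linear, cst_linear]; ring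

theorem mcSum_apply : (SBM LB UB PM).con .mcSum z = weight .i .x z := by
  simp [SBM, weight_i_x, δij, δji, Δij, coord_apply, cst_apply]; ring

theorem mcIJ_apply : (SBM LB UB PM).con .mcIJ z = weight .i .y z := by
  simp [SBM, weight_i_y, δij, Δij, coord_apply]

theorem mcJI_apply : (SBM LB UB PM).con .mcJI z = weight .j .y z := by
  simp [SBM, weight_j_y, δji, Δij, coord_apply]

theorem mcNonneg_apply : (SBM LB UB PM).con .mcNonneg z = weight .j .x z := by
  simp [SBM, weight_j_x, Δij, coord_apply]

theorem mcSum_linear : ((SBM LB UB PM).con .mcSum).linear v = weightRate .i .x v := by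
  simp [SBM, weightRate_i_x, δij, δji, Δij, coord_linear, cst_linear]; ring

theorem mcIJ_linear : ((SBM LB UB PM).con .mcIJ).linear v = weightRate .i .y v := by
  simp [SBM, weightRate_i_y, δij, Δij, coord_linear]

theorem mcJI_linear : ((SBM LB UB PM).con .mcJI).linear v = weightRate .j .y v := by
  simp [SBM, weightRate_j_y, δji, Δij, coord_linear]

theorem mcNonneg_linear : ((SBM LB UB PM).con .mcNonneg).linear v = weightRate .j .x v := by
  simp [SBM, weightRate_j_x, Δij, coord_linear]

theorem weight_nonneg (hz : (SBM LB UB PM).IsRelaxedFeasible z) (k : Obj) (s : Dir) :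
    0 ≤ weight k s z := by
  cases k <;> cases s
  · exact mcSum_apply (LB := LB) (UB := UB) (PM := PM) ▸ hz (.inl .mcSum)
  · exact mcIJ_apply (LB := LB) (UB := UB) (PM := PM) ▸ hz (.inl .mcIJ)
  · exact mcNonneg_apply (LB := LB) (UB := UB) (PM := PM) ▸ hz (.inl .mcNonneg)
  · exact mcJI_apply (LB := LB) (UB := UB) (PM := PM) ▸ hz (.inl .mcJI)

/-! ### Idealness -/

/-- At an extreme point with no weight equal to `1`, a change of the weights that fixes the
vanishing weights, here given by rates `a`, `b` of `δ_ij`, `δ_ji` and `e` of `Δ_ij`, is trivial. -/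
theorem rates_eq_zero (hLU : ∀ k s, LB k s ≤ UB k s)
    (hPM : ∀ k l s, k ≠ l → PM k l s < UB l s - LB k s)
    (hz : (SBM LB UB PM).IsExtremePoint z) (h1 : ∀ k s, weight k s z < 1) {a b e : ℝ}
    (hix : weight .i .x z = 0 → -a - b + e = 0) (hiy : weight .i .y z = 0 → a - e = 0)
    (hjx : weight .j .x z = 0 → e = 0) (hjy : weight .j .y z = 0 → b - e = 0) :
    a = 0 ∧ b = 0 := by
  have h0 := weight_nonneg hz.1
  -- `u k s` is the rate of change of the weight of the triple starting with `k` in direction `s`.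
  obtain ⟨u, hu⟩ : ∃ u : Obj → Dir → ℝ, u .i .x = -a - b + e ∧ u .i .y = a - e ∧
      u .j .x = e ∧ u .j .y = b - e :=
    ⟨fun k s => match k, s with
      | .i, .x => -a - b + e
      | .i, .y => a - e
      | .j, .x => e
      | .j, .y => b - e, rfl, rfl, rfl, rfl⟩
  obtain ⟨uix, uiy, ujx, ujy⟩ := hu
  have hu0 : ∀ k s, weight k s z = 0 → u k s = 0 := by
    rintro (_ | _) (_ | _)
    · rwa [uix]
    · rwa [uiy]
    · rwa [ujx]
    · rwa [ujy]
  have hsum : ∀ s, weight .i s z + weight .j s z ≤ 1 := by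
    have := h0 .i .x; have := h0 .i .y; have := h0 .j .x; have := h0 .j .y
    rintro (_ | _) <;> simp only [weight_i_x, weight_i_y, weight_j_x, weight_j_y] at * <;> linarith
  have hdir : ∀ s, _ := fun s =>
    have hij := prec_apply (z := z) (s := s) (LB := LB) (UB := UB) (PM := PM)
      (show Obj.i ≠ Obj.j by decide) ▸ hz.1 (.inl (.prec ⟨(.i, .j, s), Obj.noConfusion⟩))
    have hji := prec_apply (z := z) (s := s) (LB := LB) (UB := UB) (PM := PM)
      (show Obj.j ≠ Obj.i by decide) ▸ hz.1 (.inl (.prec ⟨(.j, .i, s), Obj.noConfusion⟩))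
    exists_velocity_of_weights (hLU .i s) (hLU .j s) (hPM .i .j s (by decide))
      (hPM .j .i s (by decide)) (h0 .i s) (h0 .j s) (h1 .i s) (h1 .j s) (hsum s)
      (hu0 .i s) (hu0 .j s) (sub_nonneg.1 hij) (sub_nonneg.1 hji)
  choose dx dy hlx hux hly huy hxy hyx using hdir
  let v : ContVar ⊕ BinVar → ℝ
    | .inl (.inl (.i, s)) => dx s
    | .inl (.inl (.j, s)) => dy s
    | .inl (.inr _) => e
    | .inr .ij => a
    | .inr .ji => b
  have hvu : ∀ k s, weightRate k s v = u k s := by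
    rintro (_ | _) (_ | _)
    · rw [weightRate_i_x, uix]
    · rw [weightRate_i_y, uiy]
    · rw [weightRate_j_x, ujx]
    · rw [weightRate_j_y, ujy]
  have hv : v = 0 := by
    refine hz.eq_zero_of_tight ?_
    rintro (q | y | y) hq
    · change (SBM LB UB PM).con q z = 0 at hq
      change ((SBM LB UB PM).con q).linear v = 0
      rcases q with ⟨⟨k, l, s⟩, hkl⟩ | ⟨⟨k, l, s⟩, hkl⟩ | ⟨⟨k, l, s⟩, hkl⟩ | _ | _ | _ | _
      · rw [lb_apply, sub_eq_zero] at hq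
        rw [lb_linear, hvu, sub_eq_zero]
        cases k <;> cases l
        · exact (hkl rfl).elim
        · exact hly s hq
        · exact hlx s hq
        · exact (hkl rfl).elim
      · rw [ub_apply, sub_eq_zero] at hq
        rw [ub_linear, hvu, sub_eq_zero]
        cases k <;> cases l
        · exact (hkl rfl).elim
        · exact (hux s hq.symm).symm
        · exact (huy s hq.symm).symm
        · exact (hkl rfl).elim
      · rw [prec_apply, sub_eq_zero] at hq
        rw [prec_linear, hvu, sub_eq_zero]
        cases k <;> cases l
        · exact (hkl rfl).elim
        · exact hxy s hq
        · exact hyx s hq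
        · exact (hkl rfl).elim
      · rw [mcSum_linear, hvu]; exact hu0 _ _ (mcSum_apply.symm.trans hq)
      · rw [mcIJ_linear, hvu]; exact hu0 _ _ (mcIJ_apply.symm.trans hq)
      · rw [mcJI_linear, hvu]; exact hu0 _ _ (mcJI_apply.symm.trans hq)
      · rw [mcNonneg_linear, hvu]; exact hu0 _ _ (mcNonneg_apply.symm.trans hq)
    -- A binary variable equal to `0` or `1` is a sum of two vanishing weights, or `1` minus such
    -- a sum.
    · change z (.inr y) = 0 at hq
      change v (.inr y) = 0
      have := h0 .i .y; have := h0 .j .x; have := h0 .j .y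
      rw [weight_i_y] at *
      rw [weight_j_x] at *
      rw [weight_j_y] at *
      cases y
      · linarith [hiy (by linarith), hjx (by linarith), show v (.inr .ij) = a from rfl]
      · linarith [hjy (by linarith), hjx (by linarith), show v (.inr .ji) = b from rfl]
    · change 1 - z (.inr y) = 0 at hq
      change (cst (C := ContVar) (B := BinVar) 1 - coord (.inr y)).linear v = 0
      rw [AffineMap.sub_linear, cst_linear, LinearMap.sub_apply, LinearMap.zero_apply,
        coord_linear, zero_sub, neg_eq_zero]
      have := h0 .i .x; have := h0 .i .y; have := h0 .j .y
      rw [weight_i_x] at *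
      rw [weight_i_y] at *
      rw [weight_j_y] at *
      cases y
      · linarith [hix (by linarith), hjy (by linarith), show v (.inr .ij) = a from rfl]
      · linarith [hix (by linarith), hiy (by linarith), show v (.inr .ji) = b from rfl]
  exact ⟨congrFun hv (.inr .ij), congrFun hv (.inr .ji)⟩

theorem isIdeal_SBM (hLU : ∀ k s, LB k s ≤ UB k s)
    (hPM : ∀ k l s, k ≠ l → PM k l s < UB l s - LB k s) : (SBM LB UB PM).IsIdeal := by
  intro z hz y
  by_contra! hy
  have hix := weight_nonneg hz.1 .i .x
  have hiy := weight_nonneg hz.1 .i .y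
  have hjx := weight_nonneg hz.1 .j .x
  have hjy := weight_nonneg hz.1 .j .y
  have hy0 : 0 < z (.inr y) := lt_of_le_of_ne (hz.1 (.inr (.inl y))) hy.1.symm
  have hy1 : z (.inr y) < 1 := lt_of_le_of_ne (sub_nonneg.1 (hz.1 (.inr (.inr y)))) hy.2
  have h1 : ∀ k s, weight k s z < 1 := by
    simp only [weight_i_x, weight_i_y, weight_j_x, weight_j_y] at *
    rintro (_ | _) (_ | _) <;> cases y <;>
      simp only [weight_i_x, weight_i_y, weight_j_x, weight_j_y] <;> linarith
  have hne : z (.inr y) * (1 - z (.inr y)) ≠ 0 := mul_ne_zero hy.1 (by linarith)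
  -- The rate of each weight is the weight times a factor, `-z y` or `1 - z y` according to the
  -- digit of its code that belongs to `y`.
  cases y
  · refine hne (rates_eq_zero hLU hPM hz h1 (a := z (.inr .ij) * (1 - z (.inr .ij)))
      (b := z (.inl (.inr ())) - z (.inr .ij) * z (.inr .ji))
      (e := z (.inl (.inr ())) * (1 - z (.inr .ij))) ?_ ?_ ?_ ?_).1 <;>
      simp only [weight_i_x, weight_i_y, weight_j_x, weight_j_y] <;> intro h
    · linear_combination (-z (.inr .ij)) * h
    · linear_combination (1 - z (.inr .ij)) * h
    · linear_combination (1 - z (.inr .ij)) * h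
    · linear_combination (-z (.inr .ij)) * h
  · refine hne (rates_eq_zero hLU hPM hz h1 (b := z (.inr .ji) * (1 - z (.inr .ji)))
      (a := z (.inl (.inr ())) - z (.inr .ij) * z (.inr .ji))
      (e := z (.inl (.inr ())) * (1 - z (.inr .ji))) ?_ ?_ ?_ ?_).2 <;>
      simp only [weight_i_x, weight_i_y, weight_j_x, weight_j_y] <;> intro h
    · linear_combination (-z (.inr .ji)) * h
    · linear_combination (-z (.inr .ji)) * h
    · linear_combination (1 - z (.inr .ji)) * h
    · linear_combination (1 - z (.inr .ji)) * h

end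

/-- Two objects that fit side by side fit separately. -/
theorem lowerBound_le_upperBound {r : Dir → ℝ} {d σm σp : Obj → Dir → ℝ}
    {PM : Obj → Obj → Dir → ℝ} (hd : ∀ k s, 0 ≤ d k s) (hσp : ∀ k s, 0 ≤ σp k s)
    (hM : ∀ k l s, k ≠ l → precedenceMargin d σm σp k l s ≤ PM k l s)
    (hPM : ∀ k l s, k ≠ l → PM k l s < upperBound r d σp l s - lowerBound d σm k s)
    (k : Obj) (s : Dir) : lowerBound d σm k s ≤ upperBound r d σp k s := by
  obtain ⟨l, hl⟩ : ∃ l, k ≠ l := by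
    cases k
    · exact ⟨.j, by decide⟩
    · exact ⟨.i, by decide⟩
  have h1 := hM k l s hl
  have h2 := hPM k l s hl
  have h3 := le_max_left (σp k s) (σm l s)
  simp only [precedenceMargin, lowerBound, upperBound] at *
  linarith [hd l s, hσp l s]

end RectPack

open RectPack in
/-- Pairwise-idealness of the Simple Binary Multilinear formulation. The first part is about
rectangles with clearances in a rectangular region, with precedence margins at least as large as
the dimensions and clearances require; the second part is about arbitrary parameters for which the
intervals `[LB k s, UB k s]` of admissible centre coordinates are non-empty (in the first part
this follows from the other hypotheses). -/
theorem theorem3 :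
    (∀ (r : Dir → ℝ) (d σm σp : Obj → Dir → ℝ) (PM : Obj → Obj → Dir → ℝ),
      (∀ k s, 0 ≤ d k s) → (∀ k s, 0 ≤ σm k s) → (∀ k s, 0 ≤ σp k s) →
      (∀ k l s, k ≠ l → precedenceMargin d σm σp k l s ≤ PM k l s) →
      (∀ k l s, k ≠ l → PM k l s < upperBound r d σp l s - lowerBound d σm k s) →
      (SBM (lowerBound d σm) (upperBound r d σp) PM).IsIdeal) ∧
    (∀ (LB UB : Obj → Dir → ℝ) (PM : Obj → Obj → Dir → ℝ),
      (∀ k s, LB k s ≤ UB k s) →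
      (∀ k l s, k ≠ l → PM k l s < UB l s - LB k s) →
      (SBM LB UB PM).IsIdeal) := by
  refine ⟨fun r d σm σp PM hd _ hσp hM hPM => ?_, fun LB UB PM hLU hPM => isIdeal_SBM hLU hPM⟩
  exact isIdeal_SBM (lowerBound_le_upperBound hd hσp hM hPM) hPM
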